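/- A directed graph $G$ has finite sets $V(G)$ of vertices and $E(G)$ of edges; each edge has an initial and a terminal vertex, and loops and multiple edges are allowed. A directed cycle in $G$ is a sequence $v_0,x_0,v_1,x_1,\dots,v_n,x_n,v_{n+1}=v_0$ ($n\ge 0$) with $v_0,\dots,v_n$ pairwise distinct vertices and $x_i$ an edge from $v_i$ to $v_{i+1}$; it contains the edges $x_0,\dots,x_n$. For a vertex $v$ with outgoing edges $x_1,\dots,x_m$ and incoming edges $y_1,\dots,y_r$, and for $1\le l\le k_v:=\max\{m,r\}$, put $\delta_{v,l}=e_l(x_1,\dots,x_m)-e_l(y_1,\dots,y_r)\in\mathbb Z[E(G)]$, where $e_l$ is the $l$-th elementary symmetric polynomial ($0$ if $l$ exceeds the number of variables). Let $\Delta_G=(\delta_{v,l})_{v\in V(G),\,1\le l\le k_v}$ (a family, so with multiplicity, linearly ordered in any way), and let $I(G)$ be the ideal of $\mathbb Z[E(G)]$ generated by $\Delta_G$. Let $\mathscr C_*(G)$ be the Koszul chain complex of $\Delta_G$ over $\mathbb Z[E(G)]$, $\mathscr H_*(G)$ its homology, and $\mathscr H_*^{\mathbb Q}(G)$ the homology of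 $\mathbb Q\otimes_{\mathbb Z}\mathscr C_*(G)$. For a module $M$ over a commutative ring $R$, $\operatorname{Kdim}_R M$ denotes the Krull dimension of the ring $R/\operatorname{ann}_R(M)$. **Corollary.** Let $G$ be a directed graph and $x$ an edge of $G$. The following statements are equivalent: 1. there are no directed cycles in $G$ containing $x$; 2. $\mathbb Z[x]/\operatorname{ann}_{\mathbb Z[x]}(\mathscr H_0(G))$ is a finitely generated $\mathbb Z$-module; 3. $\mathbb Z[x]/\operatorname{ann}_{\mathbb Z[x]}(\mathscr H_*(G))$ is a finitely generated $\mathbb Z$-module; 4. there is an $n\ge 1$ such that $x^n\in I(G)$; 5. $\operatorname{Kdim}_{\mathbb Z[x]}\mathscr H_0(G)=1$; 6. $\operatorname{Kdim}_{\mathbb Q[x]}\mathscr H_0^{\mathbb Q}(G)=0$. Moreover, there is a directed cycle in $G$ containing $x$ if and only if $\operatorname{Kdim}_{\mathbb Q[x]}\mathscr H_0^{\mathbb Q}(G)=\operatorname{Kdim}_{\mathbb Z[x]}\mathscr H_0(G)-1=1$. -/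

import Mathlib

open scoped DirectSum

universe u v w

/-- The module of Koszul `n`-chains on a family of elements indexed by `ι`: the free `R`-module on
the `n`-element subsets of `ι`. The subset `S` stands for the standard basis element `1_ε`, with
`ε j = 1` exactly when `j ∈ S`. -/
abbrev KoszulChain (R : Type u) (ι : Type v) (n : ℕ) : Type (max u v) :=
  {S : Finset ι // S.card = n} → R

/-- The Koszul differential
`d (1_S) = ∑_{j ∈ S} (-1) ^ #{i ∈ S | i < j} • r_j • 1_{S \ {j}}`, written in coordinates: the
coefficient of `d f` at `T` collects the contributions of the sets `S = T ∪ {j}` with `j ∉ T`. -/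
def koszulD {R : Type u} [CommRing R] {ι : Type v} [Fintype ι] [LinearOrder ι] (r : ι → R)
    (n : ℕ) : KoszulChain R ι (n + 1) →ₗ[R] KoszulChain R ι n where
  toFun f T := ∑ j : {j : ι // j ∉ T.1},
    (-1) ^ (T.1.filter (fun i => i < j.1)).card * r j.1 *
      f ⟨insert j.1 T.1, by rw [Finset.card_insert_of_notMem j.2, T.2]⟩
  map_add' f g := by
    funext T
    simp only [Pi.add_apply, mul_add, Finset.sum_add_distrib]
  map_smul' c f := by
    funext T
    simp only [Pi.smul_apply, smul_eq_mul, RingHom.id_apply, Finset.mul_sum]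
    exact Finset.sum_congr rfl fun j _ => by ring

theorem koszulD_comp_koszulD {R : Type u} [CommRing R] {ι : Type v} [Fintype ι] [LinearOrder ι]
    (r : ι → R) (n : ℕ) : koszulD r n ∘ₗ koszulD r (n + 1) = 0 := by
  refine LinearMap.ext fun f => funext fun T => ?_
  change (∑ j : {j : ι // j ∉ T.1}, (-1) ^ (T.1.filter (fun i => i < j.1)).card * r j.1 *
    ∑ k : {k : ι // k ∉ insert j.1 T.1},
      (-1) ^ ((insert j.1 T.1).filter (fun i => i < k.1)).card * r k.1 *
        f ⟨insert k.1 (insert j.1 T.1), _⟩) = 0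
  simp only [Finset.mul_sum]
  rw [Finset.sum_sigma']
  have hne : ∀ a : (j : {j : ι // j ∉ T.1}) × {k : ι // k ∉ insert j.1 T.1},
      a.2.1 ≠ a.1.1 ∧ a.2.1 ∉ T.1 := fun a => by
    have := a.2.2
    rwa [Finset.mem_insert, not_or] at this
  have hsign : ∀ j k : ι, j ∉ T.1 → ((-1 : R)) ^ ((insert j T.1).filter (fun i => i < k)).card =
      (if j < k then -1 else 1) * (-1) ^ (T.1.filter (fun i => i < k)).card := by
    intro j k hj
    rw [Finset.filter_insert]
    split_ifs with h
    · rw [Finset.card_insert_of_notMem (fun h' => hj (Finset.mem_filter.1 h').1), pow_succ']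
    · rw [one_mul]
  refine Finset.sum_involution
    (fun a _ => ⟨⟨a.2.1, (hne a).2⟩, ⟨a.1.1, by
      rw [Finset.mem_insert, not_or]
      exact ⟨(hne a).1.symm, a.1.2⟩⟩⟩) ?_ ?_ ?_ ?_
  · intro a _
    have hf : ∀ h h', f ⟨insert a.2.1 (insert a.1.1 T.1), h⟩ =
        f ⟨insert a.1.1 (insert a.2.1 T.1), h'⟩ := fun h h' =>
      congrArg f (Subtype.ext (Finset.insert_comm _ _ _))
    have hc : (insert a.1.1 (insert a.2.1 T.1)).card = n + 1 + 1 := by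
      rw [Finset.card_insert_of_notMem, Finset.card_insert_of_notMem (hne a).2, T.2]
      rw [Finset.mem_insert, not_or]
      exact ⟨(hne a).1.symm, a.1.2⟩
    rw [hsign _ _ a.1.2, hsign _ _ (hne a).2, hf _ hc]
    rcases lt_or_gt_of_ne (hne a).1 with h | h
    · rw [if_neg h.not_gt, if_pos h]
      ring
    · rw [if_pos h, if_neg h.not_gt]
      ring
  · intro a _ _ h
    exact (hne a).1 (congrArg (fun b => b.1.1) h)
  · intro a _
    exact Finset.mem_univ _
  · intro a _
    rfl

/-- The Koszul chain complex over `R` of a finite family `r` of elements of `R`. -/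
noncomputable def koszulComplex {R : Type u} [CommRing R] {ι : Type v} [Fintype ι] [LinearOrder ι]
    (r : ι → R) : ChainComplex (ModuleCat.{max u v} R) ℕ :=
  ChainComplex.of (fun n => ModuleCat.of R (KoszulChain R ι n))
    (fun n => ModuleCat.ofHom (koszulD r n))
    (fun n => by
      rw [← ModuleCat.ofHom_comp, koszulD_comp_koszulD]
      rfl)

instance extendScalars_additive {R S : Type v} [CommRing R] [CommRing S] (f : R →+* S) :
    (ModuleCat.extendScalars.{v, v, w} f).Additive where
  map_add {M N g h} := by
    refine ModuleCat.ExtendScalars.hom_ext fun m => ?_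
    let := f.toAlgebra
    exact TensorProduct.tmul_add (R := R) (M := S) (1 : S) (g m) (h m)

/-- A directed graph with vertex set `V` and edge set `E`; loops and multiple edges are allowed. -/
structure DirectedGraph (V : Type u) (E : Type v) where
  /-- the initial vertex of an edge -/
  init : E → V
  /-- the terminal vertex of an edge -/
  term : E → V

/-- A directed cycle: distinct vertices `v_0, …, v_n` and edges `x_0, …, x_n`, where `x_i` goes
from `v_i` to `v_{i+1}` and `v_{n+1} = v_0` (addition in `Fin (n + 1)` is cyclic). -/
structure DirectedGraph.Cycle {V : Type u} {E : Type v} (G : DirectedGraph V E) where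
  n : ℕ
  vertex : Fin (n + 1) → V
  edge : Fin (n + 1) → E
  vertex_injective : Function.Injective vertex
  init_edge : ∀ i, G.init (edge i) = vertex i
  term_edge : ∀ i, G.term (edge i) = vertex (i + 1)

/-- There is a directed cycle in `G` that contains the edge `x`. -/
def DirectedGraph.HasCycleThrough {V : Type u} {E : Type v} (G : DirectedGraph V E) (x : E) :
    Prop :=
  ∃ C : G.Cycle, ∃ i, C.edge i = x

/-- The `l`-th elementary symmetric polynomial in the variables of the finite set `S`. -/
noncomputable def esymmOn {E : Type v} (S : Finset E) (l : ℕ) : MvPolynomial E ℤ :=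
  ∑ T ∈ S.powersetCard l, ∏ e ∈ T, MvPolynomial.X e

namespace DirectedGraph

variable {V : Type u} {E : Type v} [DecidableEq V] [Fintype E] (G : DirectedGraph V E)

/-- The edges with initial vertex `v`. -/
def outEdges (v : V) : Finset E := Finset.univ.filter (fun e => G.init e = v)

/-- The edges with terminal vertex `v`. -/
def inEdges (v : V) : Finset E := Finset.univ.filter (fun e => G.term e = v)

/-- `k_v`, the maximum of the out-degree and the in-degree of `v`. -/
def maxDegree (v : V) : ℕ := max (G.outEdges v).card (G.inEdges v).card

/-- The incidence relation `δ_{v,l} = e_l(x_1, …, x_m) - e_l(y_1, …, y_n)` at `v`, where the `x_i`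
are the edges leaving `v` and the `y_j` are the edges entering `v`. -/
noncomputable def incidenceRelation (v : V) (l : ℕ) : MvPolynomial E ℤ :=
  esymmOn (G.outEdges v) l - esymmOn (G.inEdges v) l

/-- The index set of the family `Δ_G`: the pairs `(v, l)` with `1 ≤ l ≤ k_v`. The pair `(v, l)` is
represented by `⟨v, l - 1⟩`. -/
def RelationIndex : Type u := Σ v : V, Fin (G.maxDegree v)

instance [Fintype V] : Fintype G.RelationIndex :=
  inferInstanceAs (Fintype (Σ v : V, Fin (G.maxDegree v)))

/-- The family `Δ_G` of all incidence relations of `G`. -/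
noncomputable def relations (i : G.RelationIndex) : MvPolynomial E ℤ :=
  G.incidenceRelation i.1 (i.2.1 + 1)

/-- The incidence ideal `I(G)`. -/
noncomputable def incidenceIdeal : Ideal (MvPolynomial E ℤ) :=
  Ideal.span (Set.range G.relations)

variable [Fintype V] [LinearOrder G.RelationIndex]

/-- The Khovanov-Rozansky chain complex of `G`: the Koszul complex of `Δ_G` over `ℤ[E(G)]`, for the
given linear order of `Δ_G`. -/
noncomputable def KRComplex : ChainComplex (ModuleCat.{max u v} (MvPolynomial E ℤ)) ℕ :=
  koszulComplex G.relations

/-- The Khovanov-Rozansky homology of `G` in homological degree `n`. -/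
noncomputable abbrev KRHomology (n : ℕ) : ModuleCat.{max u v} (MvPolynomial E ℤ) :=
  G.KRComplex.homology n

/-- The total Khovanov-Rozansky homology of `G`. -/
abbrev TotalKRHomology : Type (max u v) := ⨁ n, G.KRHomology n

/-- The Khovanov-Rozansky chain complex over `ℚ`, that is, `ℚ ⊗_ℤ -` of the integral complex. It is
a complex of modules over `ℚ[E(G)] = ℚ ⊗_ℤ ℤ[E(G)]`, and is obtained as
`ℚ[E(G)] ⊗_{ℤ[E(G)]} -`. -/
noncomputable def KRComplexRat : ChainComplex (ModuleCat.{max u v} (MvPolynomial E ℚ)) ℕ :=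
  ((ModuleCat.extendScalars.{v, v, max u v}
    (MvPolynomial.map (σ := E) (Int.castRingHom ℚ))).mapHomologicalComplex _).obj G.KRComplex

/-- The zeroth Khovanov-Rozansky homology of `G` over `ℚ`. -/
noncomputable abbrev KRHomologyRatZero : ModuleCat.{max u v} (MvPolynomial E ℚ) :=
  G.KRComplexRat.homology 0

end DirectedGraph

/-- The inclusion of the subring `k[x]`, generated by the single variable `x`, into the polynomial
ring `k[E]`. -/
noncomputable def edgeInclusion (k : Type w) [CommRing k] {E : Type v} (x : E) :
    Polynomial k →+* MvPolynomial E k :=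
  (Polynomial.aeval (MvPolynomial.X x : MvPolynomial E k)).toRingHom

/-- The annihilator `ann_A(M) = {a ∈ A | a m = 0 for all m ∈ M}` of an `R`-module `M`, regarded as
an `A`-module through a ring homomorphism `φ : A → R`. -/
def annOver {A : Type u} {R : Type v} [CommRing A] [CommRing R] (φ : A →+* R) (M : Type w)
    [AddCommGroup M] [Module R M] : Ideal A where
  carrier := {a | ∀ m : M, φ a • m = 0}
  add_mem' ha hb m := by rw [map_add, add_smul, ha m, hb m, add_zero]
  zero_mem' m := by rw [map_zero, zero_smul]
  smul_mem' c a ha m := by rw [smul_eq_mul, map_mul, mul_smul, ha m, smul_zero]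

/-- The Krull dimension `Kdim_A M = Kdim (A / ann_A(M))` of an `R`-module `M`, regarded as an
`A`-module through a ring homomorphism `φ : A → R`. -/
noncomputable def KdimOver {A : Type u} {R : Type v} [CommRing A] [CommRing R] (φ : A →+* R)
    (M : Type w) [AddCommGroup M] [Module R M] : WithBot ℕ∞ :=
  ringKrullDim (A ⧸ annOver φ M)

/-! Everything depends on the ideal `J = I(G) ∩ k[x]` for `k = ℤ`, and on its analogue for the
extended ideal over `k = ℚ`. A Koszul complex has `H_0 = R/I`, and `I` kills all of its homology, so
the annihilators of `H_0` and of the total homology in `ℤ[x]` are both `J`.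

If `x` lies on a cycle, send the edges of the cycle to `X` and all others to `0`. This kills `I(G)`
and is the identity on `k[x]`, so `J = 0` and the quotient is `k[x]`: not finite over `ℤ`, of
dimension 2 over `ℤ` and 1 over `ℚ`.

If `x` lies on no cycle, let `P` be a prime containing `I(G)`. In the domain `ℤ[E]/P` the relations
force the outgoing and incoming edges at each vertex to take the same nonzero values with
multiplicity (`Multiset.count_eq_of_esymm_eq`). If `x ∉ P`, the edges with the value of `x` would
thus be balanced at every vertex, and in a balanced set each edge lies on a cycle
(`hasCycleThrough_of_balanced`). So `x` lies in every such `P`, that is, `x ^ n ∈ I(G)` for some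
`n`. Sending all edges to `0` shows `J ≤ (x)`, so `J` has the zero locus of `(x)` and the quotient
has the dimension of `k`. -/

namespace Multiset

/-! ### Elementary symmetric functions determine the nonzero elements -/

theorem esymm_cons_zero {R : Type*} [CommSemiring R] (s : Multiset R) (l : ℕ) :
    ((0 : R) ::ₘ s).esymm l = s.esymm l := by
  cases l with
  | zero => simp [esymm]
  | succ l => simp [esymm, powersetCard_cons]

theorem esymm_replicate_zero_add {R : Type*} [CommSemiring R] (s : Multiset R) (k l : ℕ) :
    (replicate k (0 : R) + s).esymm l = s.esymm l := by
  induction k with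
  | zero => simp
  | succ k ih => rw [replicate_succ, cons_add, esymm_cons_zero, ih]

theorem esymm_eq_zero_of_card_lt {R : Type*} [CommSemiring R] {s : Multiset R} {l : ℕ}
    (h : card s < l) : s.esymm l = 0 := by
  simp [esymm, powersetCard_eq_empty l h]

/-- Two multisets of equal size in a domain with the same elementary symmetric functions agree. -/
theorem eq_of_esymm_eq {R : Type*} [CommRing R] [IsDomain R] {s t : Multiset R}
    (hc : card s = card t) (h : ∀ l, s.esymm l = t.esymm l) : s = t := by
  -- By Vieta, both are the root multiset of the same monic polynomial.
  rw [← Polynomial.roots_multiset_prod_X_sub_C s, ← Polynomial.roots_multiset_prod_X_sub_C t,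
    prod_X_sub_X_eq_sum_esymm, prod_X_sub_X_eq_sum_esymm, hc]
  simp only [h]

/-- Two multisets in a domain with the same elementary symmetric functions have the same nonzero
elements, with multiplicity. -/
theorem count_eq_of_esymm_eq {R : Type*} [CommRing R] [IsDomain R] [DecidableEq R]
    {s t : Multiset R} (h : ∀ l, s.esymm l = t.esymm l) {c : R} (hc : c ≠ 0) :
    s.count c = t.count c := by
  -- Zeros do not affect `esymm`, so padding reduces to equal sizes without changing the count of `c
  -- ≠ 0`.
  have key : replicate (card t) (0 : R) + s = replicate (card s) 0 + t := by
    refine eq_of_esymm_eq (by simp [add_comm]) fun l => ?_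
    rw [esymm_replicate_zero_add, esymm_replicate_zero_add, h]
  simpa [count_replicate, hc.symm] using congrArg (count c) key

end Multiset

/-! ### Incidence relations under ring homomorphisms -/

theorem map_esymmOn {E : Type v} {D : Type w} [CommRing D] (φ : MvPolynomial E ℤ →+* D)
    (S : Finset E) (l : ℕ) :
    φ (esymmOn S l) = (S.val.map fun e => φ (MvPolynomial.X e)).esymm l := by
  simp [esymmOn, Finset.esymm_map_val]

namespace DirectedGraph

variable {V : Type u} {E : Type v}

/-- The bounds `1 ≤ l ≤ k_v` lose nothing: in degree 0 both sides are 1, and above `k_v` both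
vanish. -/
theorem incidenceIdeal_le_ker_iff [DecidableEq V] [Fintype E] (G : DirectedGraph V E)
    {D : Type w} [CommRing D] (φ : MvPolynomial E ℤ →+* D) :
    G.incidenceIdeal ≤ RingHom.ker φ ↔
      ∀ v l, ((G.outEdges v).val.map fun e => φ (MvPolynomial.X e)).esymm l =
        ((G.inEdges v).val.map fun e => φ (MvPolynomial.X e)).esymm l := by
  rw [incidenceIdeal, Ideal.span_le, Set.range_subset_iff]
  have hrel : ∀ v l, φ (G.incidenceRelation v l) = 0 ↔
      ((G.outEdges v).val.map fun e => φ (MvPolynomial.X e)).esymm l =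
        ((G.inEdges v).val.map fun e => φ (MvPolynomial.X e)).esymm l := fun v l => by
    rw [incidenceRelation, map_sub, map_esymmOn, map_esymmOn, sub_eq_zero]
  refine ⟨fun h v l => ?_, fun h i => (hrel _ _).2 (h _ _)⟩
  rcases Nat.eq_zero_or_pos l with rfl | hl
  · simp [Multiset.esymm]
  rcases le_or_gt l (G.maxDegree v) with hlv | hlv
  · obtain ⟨k, rfl⟩ := Nat.exists_eq_add_of_lt hl
    exact (hrel _ _).1 (by simpa [relations] using h ⟨v, ⟨k, by omega⟩⟩)
  · rw [maxDegree, max_lt_iff] at hlv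
    rw [Multiset.esymm_eq_zero_of_card_lt (by simpa using hlv.1),
      Multiset.esymm_eq_zero_of_card_lt (by simpa using hlv.2)]

/-! ### Walks, balanced edge sets and cycles -/

/-- There is a walk of length `n` from `a` to `b` along edges in `F`, given by its vertices and
edges (only the first ones matter). -/
def IsWalk (G : DirectedGraph V E) (F : Finset E) (a b : V) (n : ℕ) (p : ℕ → V) (q : ℕ → E) :
    Prop :=
  p 0 = a ∧ p n = b ∧ ∀ i < n, q i ∈ F ∧ G.init (q i) = p i ∧ G.term (q i) = p (i + 1)

/-- Cutting out the stretch between two visits to a vertex would give a shorter walk. -/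
theorem IsWalk.injOn_of_minimal {G : DirectedGraph V E} {F : Finset E} {a b : V} {n : ℕ}
    {p : ℕ → V} {q : ℕ → E} (h : G.IsWalk F a b n p q)
    (hmin : ∀ m < n, ¬ ∃ p q, G.IsWalk F a b m p q) {i j : ℕ} (hij : i < j) (hj : j ≤ n) :
    p i ≠ p j := by
  intro heq
  refine hmin (n - (j - i)) (by omega)
    ⟨fun k => if k ≤ i then p k else p (k + (j - i)),
      fun k => if k < i then q k else q (k + (j - i)), ?_, ?_, fun k hk => ?_⟩
  · simpa using h.1
  -- If `j = n`, the shortened walk ends at index `i` itself, before the shift sets in.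
  · rcases hj.lt_or_eq with hj | rfl
    · simp only
      rw [if_neg (by omega), ← h.2.1]
      congr 1
      omega
    · simp only
      rw [if_pos (by omega), ← h.2.1, ← heq]
      congr 1
      omega
  · rcases lt_trichotomy k i with hki | rfl | hki
    · simpa [hki, hki.le, Nat.succ_le_of_lt hki] using h.2.2 k (by omega)
    · have hk' : k + (j - k) = j := by omega
      have hk'' : k + 1 + (j - k) = j + 1 := by omega
      simpa [hk', hk'', heq] using h.2.2 j (by omega)
    · have hk' : k + 1 + (j - i) = k + (j - i) + 1 := by omega
      simpa [hki.not_gt, hki.not_ge, hk', show ¬ k + 1 ≤ i by omega]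
        using h.2.2 (k + (j - i)) (by omega)

/-- A shortest walk has distinct vertices, and `x` closes it up as the last edge; length 0 is the
case of a loop. -/
theorem hasCycleThrough_of_isWalk (G : DirectedGraph V E) {F : Finset E} {x : E}
    (h : ∃ n p q, G.IsWalk F (G.term x) (G.init x) n p q) : G.HasCycleThrough x := by
  classical
  obtain ⟨p, q, hw⟩ := Nat.find_spec h
  have hmin : ∀ m < Nat.find h, ¬ ∃ p q, G.IsWalk F (G.term x) (G.init x) m p q :=
    fun m hm => Nat.find_min h hm
  generalize Nat.find h = n at hw hmin
  have hlast : ∀ i : Fin (n + 1), ¬ (i : ℕ) < n → i = Fin.last n := fun i hi =>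
    Fin.ext (by rw [Fin.val_last]; omega)
  refine ⟨⟨n, fun i => p i, fun i => if (i : ℕ) < n then q i else x, fun i j hij => ?_,
    fun i => ?_, fun i => ?_⟩, Fin.last n, by simp⟩
  · by_contra hne
    rcases lt_or_gt_of_ne (fun h' => hne (Fin.ext h') : (i : ℕ) ≠ j) with hlt | hlt
    · exact hw.injOn_of_minimal hmin hlt (by omega) hij
    · exact hw.injOn_of_minimal hmin hlt (by omega) hij.symm
  · split_ifs with hi
    · exact (hw.2.2 i hi).2.1
    · rw [hlast i hi, Fin.val_last, hw.2.1]
  · split_ifs with hi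
    · rw [(hw.2.2 i hi).2.2, Fin.val_add_one_of_lt (Fin.lt_def.2 (by simpa using hi))]
    · rw [hlast i hi, Fin.last_add_one, Fin.val_zero, hw.1]

/-- In a finite set of edges that leaves and enters every vertex equally often, every edge lies on
a directed cycle. -/
theorem hasCycleThrough_of_balanced [Fintype V] [DecidableEq V] (G : DirectedGraph V E)
    (F : Finset E)
    (hF : ∀ v, (F.filter fun e => G.init e = v).card = (F.filter fun e => G.term e = v).card)
    {x : E} (hx : x ∈ F) : G.HasCycleThrough x := by
  classical
  refine G.hasCycleThrough_of_isWalk (F := F) ?_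
  -- No edge of `F` leaves the set `S` of vertices reachable from `term x`. Summing the balance over
  -- `S`, as many edges start in `S` as end there, so every edge ending in `S`, such as `x`, also
  -- starts in it.
  set S : Finset V := Finset.univ.filter fun v => ∃ n p q, G.IsWalk F (G.term x) v n p q with hS
  have hclosed : ∀ e ∈ F, G.init e ∈ S → G.term e ∈ S := by
    intro e he hi
    obtain ⟨n, p, q, hw⟩ := (Finset.mem_filter.1 hi).2
    refine Finset.mem_filter.2 ⟨Finset.mem_univ _, n + 1,
      fun k => if k ≤ n then p k else G.term e, fun k => if k < n then q k else e, ?_, ?_,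
      fun k hk => ?_⟩
    · simpa using hw.1
    · simp
    · rcases Nat.lt_succ_iff_lt_or_eq.1 hk with hk | rfl
      · simpa [hk, hk.le, Nat.succ_le_of_lt hk] using hw.2.2 k hk
      · simpa [he] using hw.2.1.symm
  have hcard : (F.filter fun e => G.init e ∈ S).card = (F.filter fun e => G.term e ∈ S).card := by
    have hsum : ∀ f : E → V, (F.filter fun e => f e ∈ S).card =
        ∑ v ∈ S, (F.filter fun e => f e = v).card := fun f => by
      rw [Finset.card_eq_sum_card_fiberwise (f := f) (t := S)
        (s := F.filter fun e => f e ∈ S) fun e he => (Finset.mem_filter.1 he).2]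
      refine Finset.sum_congr rfl fun v hv => ?_
      rw [Finset.filter_filter]
      congr 1
      ext e
      simp only [Finset.mem_filter]
      constructor
      · rintro ⟨h1, -, h2⟩
        exact ⟨h1, h2⟩
      · rintro ⟨h1, rfl⟩
        exact ⟨h1, hv, rfl⟩
    rw [hsum, hsum, Finset.sum_congr rfl fun v _ => hF v]
  have hsub : (F.filter fun e => G.init e ∈ S) ⊆ F.filter fun e => G.term e ∈ S := fun e he => by
    rw [Finset.mem_filter] at he ⊢
    exact ⟨he.1, hclosed e he.1 he.2⟩
  have hxS : x ∈ F.filter fun e => G.term e ∈ S :=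
    Finset.mem_filter.2 ⟨hx, Finset.mem_filter.2 ⟨Finset.mem_univ _, 0, fun _ => G.term x,
      fun _ => x, rfl, rfl, fun i hi => absurd hi (Nat.not_lt_zero i)⟩⟩
  rw [← Finset.eq_of_subset_of_card_le hsub hcard.ge] at hxS
  exact (Finset.mem_filter.1 (Finset.mem_filter.1 hxS).2).2

/-- If an edge does not map to zero in a domain that satisfies the incidence relations, then it
lies on a directed cycle. -/
theorem hasCycleThrough_of_map_ne_zero [Fintype V] [DecidableEq V] [Fintype E]
    (G : DirectedGraph V E) {D : Type w} [CommRing D] [IsDomain D] (φ : MvPolynomial E ℤ →+* D)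
    (hφ : G.incidenceIdeal ≤ RingHom.ker φ) {x : E} (hx : φ (MvPolynomial.X x) ≠ 0) :
    G.HasCycleThrough x := by
  classical
  rw [incidenceIdeal_le_ker_iff] at hφ
  refine G.hasCycleThrough_of_balanced
    (Finset.univ.filter fun e => φ (MvPolynomial.X x) = φ (MvPolynomial.X e)) (fun v => ?_)
    (by simp)
  have h := Multiset.count_eq_of_esymm_eq (hφ v) hx
  rw [Multiset.count_map, Multiset.count_map, ← Finset.filter_val, ← Finset.filter_val,
    Finset.card_val, Finset.card_val, outEdges, inEdges] at h
  rwa [Finset.filter_comm, Finset.filter_comm (p := fun e => _ = _)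
    (q := fun e => G.term e = v)]

/-- The radical is the intersection of the primes above the ideal, and each of these gives a domain
quotient. -/
theorem exists_pow_mem_incidenceIdeal [Fintype V] [DecidableEq V] [Fintype E]
    (G : DirectedGraph V E) {x : E} (hx : ¬ G.HasCycleThrough x) :
    ∃ n : ℕ, 1 ≤ n ∧ (MvPolynomial.X x : MvPolynomial E ℤ) ^ n ∈ G.incidenceIdeal := by
  have hrad : (MvPolynomial.X x : MvPolynomial E ℤ) ∈ G.incidenceIdeal.radical := by
    rw [Ideal.radical_eq_sInf, Submodule.mem_sInf]
    rintro P ⟨hIP, hP⟩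
    by_contra hxP
    refine hx (G.hasCycleThrough_of_map_ne_zero (Ideal.Quotient.mk P) (by rwa [Ideal.mk_ker]) ?_)
    rwa [Ne, Ideal.Quotient.eq_zero_iff_mem]
  obtain ⟨n, hn⟩ := hrad
  exact ⟨n + 1, by omega, by rw [pow_succ]; exact Ideal.mul_mem_right _ _ hn⟩

/-! ### Specialization along a directed cycle -/

theorem Cycle.edge_injective {G : DirectedGraph V E} (C : G.Cycle) :
    Function.Injective C.edge := fun i j h =>
  C.vertex_injective (by rw [← C.init_edge, ← C.init_edge, h])

theorem Cycle.card_out_eq_card_in [DecidableEq V] [Fintype E] {G : DirectedGraph V E}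
    (C : G.Cycle) [DecidablePred (· ∈ Set.range C.edge)] (v : V) :
    ((G.outEdges v).filter (· ∈ Set.range C.edge)).card =
      ((G.inEdges v).filter (· ∈ Set.range C.edge)).card := by
  classical
  have hcard : ∀ f : E → V, ((Finset.univ.filter fun e => f e = v).filter
      (· ∈ Set.range C.edge)).card = (Finset.univ.filter fun i => f (C.edge i) = v).card := by
    intro f
    rw [← Finset.card_image_of_injective _ C.edge_injective]
    congr 1
    ext e
    simp only [Finset.mem_filter, Finset.mem_univ, true_and, Finset.mem_image, Set.mem_range]
    constructor
    · rintro ⟨h, i, rfl⟩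
      exact ⟨i, h, rfl⟩
    · rintro ⟨i, h, rfl⟩
      exact ⟨h, i, rfl⟩
  rw [outEdges, inEdges, hcard, hcard]
  simp only [C.init_edge, C.term_edge]
  symm
  -- The cycle edge `i` entering `v` is followed by the cycle edge `i + 1` leaving it.
  refine Finset.card_bij (fun i _ => i + 1) (by simp) (fun i _ j _ h => add_right_cancel h) ?_
  intro i hi
  exact ⟨i - 1, by simpa using hi, by simp⟩

/-- The assignment of the variable `X` to the edges of a directed cycle and of zero to all other
edges satisfies the incidence relations. -/
theorem Cycle.incidenceIdeal_le_ker [DecidableEq V] [Fintype E] {G : DirectedGraph V E}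
    (C : G.Cycle) [DecidablePred (· ∈ Set.range C.edge)] {D : Type w} [CommRing D]
    (c : D) (φ : MvPolynomial E ℤ →+* D)
    (hφ : ∀ e, φ (MvPolynomial.X e) = if e ∈ Set.range C.edge then c else 0) :
    G.incidenceIdeal ≤ RingHom.ker φ := by
  classical
  rw [incidenceIdeal_le_ker_iff]
  intro v l
  simp only [hφ]
  -- Zeros being invisible to `esymm`, only the number of cycle edges in `S` matters.
  have hmap : ∀ S : Finset E,
      (S.val.map fun e => if e ∈ Set.range C.edge then c else 0).esymm l =
        (Multiset.replicate (S.filter (· ∈ Set.range C.edge)).card c).esymm l := by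
    intro S
    conv_lhs => rw [← Multiset.filter_add_not (· ∈ Set.range C.edge) S.val, Multiset.map_add,
      add_comm]
    have h1 : (S.val.filter (· ∈ Set.range C.edge)).map
        (fun e => if e ∈ Set.range C.edge then c else 0) =
        Multiset.replicate (S.filter (· ∈ Set.range C.edge)).card c := by
      rw [Multiset.map_congr rfl fun e he => if_pos (Multiset.mem_filter.1 he).2,
        Multiset.map_const']
      rfl
    have h0 : (S.val.filter fun e => ¬ e ∈ Set.range C.edge).map
        (fun e => if e ∈ Set.range C.edge then c else 0) =
        Multiset.replicate (S.val.filter fun e => ¬ e ∈ Set.range C.edge).card 0 := by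
      rw [Multiset.map_congr rfl fun e he => if_neg (Multiset.mem_filter.1 he).2,
        Multiset.map_const']
    rw [h1, h0, Multiset.esymm_replicate_zero_add]
  rw [hmap, hmap, C.card_out_eq_card_in]

end DirectedGraph

/-! ### Annihilators of homology in terms of cycles and boundaries -/

open CategoryTheory in
/-- An element that sends all cycles to boundaries annihilates the homology. -/
theorem smul_homology_eq_zero {R : Type u} [CommRing R] (K : ChainComplex (ModuleCat.{w} R) ℕ)
    (n : ℕ) (a : R)
    (h : ∀ z : K.X n, (∀ j, (K.d n j).hom z = 0) → a • z ∈ LinearMap.range (K.d (n + 1) n).hom)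
    (m : K.homology n) : a • m = 0 := by
  obtain ⟨z, rfl⟩ := (ModuleCat.epi_iff_surjective (K.homologyπ n)).1 inferInstance m
  obtain ⟨y, hy⟩ := h ((K.iCycles n).hom z) fun j => by
    exact congrArg (fun f => f.hom z) (K.iCycles_d n j)
  have hz : a • z = (K.toCycles (n + 1) n).hom y := by
    refine (ModuleCat.mono_iff_injective (K.iCycles n)).1 inferInstance ?_
    have := congrArg (fun f => f.hom y) (K.toCycles_i (n + 1) n)
    simp only [ModuleCat.hom_comp, LinearMap.comp_apply] at this
    rw [map_smul]
    exact hy.symm.trans this.symm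
  have h0 := congrArg (fun f => f.hom y) (K.toCycles_comp_homologyπ (n + 1) n)
  simp only [ModuleCat.hom_comp, LinearMap.comp_apply, ModuleCat.hom_zero,
    LinearMap.zero_apply] at h0
  rw [← map_smul, hz]
  exact h0

open CategoryTheory in
theorem smul_homology_zero_iff {R : Type u} [CommRing R] (K : ChainComplex (ModuleCat.{w} R) ℕ)
    (a : R) :
    (∀ m : K.homology 0, a • m = 0) ↔
      ∀ z : K.X 0, a • z ∈ LinearMap.range (K.d 1 0).hom := by
  refine ⟨fun h z => ?_, fun h => smul_homology_eq_zero K 0 a fun z _ => h z⟩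
  set N := LinearMap.range (K.d 1 0).hom
  -- This projection factors through the opcycles, which in degree 0 are the homology.
  let k : K.X 0 ⟶ ModuleCat.of R (K.X 0 ⧸ N) := ModuleCat.ofHom N.mkQ
  have hk : K.d 1 0 ≫ k = 0 := by
    ext y
    exact (Submodule.Quotient.mk_eq_zero N).2 ⟨y, rfl⟩
  have hz : a • (K.pOpcycles 0).hom z = 0 := by
    have hinj := (ModuleCat.mono_iff_injective K.isoHomologyι₀.inv).1 inferInstance
    refine hinj ?_
    rw [map_zero]
    exact (map_smul K.isoHomologyι₀.inv.hom a _).trans (h _)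
  have hd := congrArg (fun f => f.hom (a • z)) (K.p_descOpcycles k 1 (by simp) hk)
  simp only [ModuleCat.hom_comp, LinearMap.comp_apply, map_smul] at hd
  rw [← map_smul, hz, map_zero, ← map_smul] at hd
  exact (Submodule.Quotient.mk_eq_zero N).1 hd.symm

/-! ### Koszul homology and its annihilator -/

section Koszul

variable {R : Type u} [CommRing R] {ι : Type v} [Fintype ι] [LinearOrder ι]

/-- Exterior multiplication by the basis element `1_j`, a contracting homotopy for `r_j`. -/
def koszulHomotopy (j : ι) (n : ℕ) (f : KoszulChain R ι n) : KoszulChain R ι (n + 1) := fun S =>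
  if h : j ∈ S.1 then
    (-1) ^ ((S.1.erase j).filter (fun i => i < j)).card *
      f ⟨S.1.erase j, by rw [Finset.card_erase_of_mem h, S.2, Nat.add_sub_cancel]⟩
  else 0

/-- Only the term that inserts `j` survives, and its two equal signs cancel; no cycle condition is
needed. -/
theorem koszulD_koszulHomotopy_of_notMem (r : ι → R) (j : ι) (n : ℕ) (f : KoszulChain R ι n)
    (T : {S : Finset ι // S.card = n}) (hj : j ∉ T.1) :
    koszulD r n (koszulHomotopy j n f) T = r j * f T := by
  change (∑ k : {k : ι // k ∉ T.1}, (-1) ^ (T.1.filter (fun i => i < k.1)).card * r k.1 *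
      koszulHomotopy j n f ⟨insert k.1 T.1, _⟩) = _
  rw [Finset.sum_eq_single ⟨j, hj⟩]
  · have hT : (insert j T.1).erase j = T.1 := Finset.erase_insert hj
    rw [koszulHomotopy, dif_pos (Finset.mem_insert_self _ _)]
    simp only [hT]
    rw [mul_mul_mul_comm, mul_comm, mul_comm (_ ^ _), ← mul_assoc, mul_comm (r j * _)]
    have : ((-1 : R)) ^ (T.1.filter (fun i => i < j)).card *
        (-1) ^ (T.1.filter (fun i => i < j)).card = 1 := by
      rw [← mul_pow]
      simp
    linear_combination (r j * f T) * this
  · rintro ⟨k, hk⟩ - hne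
    rw [koszulHomotopy, dif_neg, mul_zero]
    rw [Finset.mem_insert, not_or]
    exact ⟨fun h => hne (Subtype.ext h.symm), hj⟩
  · exact fun h => absurd (Finset.mem_univ _) h

/-- If `f` is a cycle, then `r_j • f` is the boundary of its product with `1_j`. -/
theorem koszulD_koszulHomotopy (r : ι → R) (j : ι) (n : ℕ) (f : KoszulChain R ι n)
    (hf : ∀ m (h : n = m + 1), koszulD r m (fun S => f ⟨S.1, S.2.trans h.symm⟩) = 0) :
    koszulD r n (koszulHomotopy j n f) = r j • f := by
  funext T
  by_cases hj : j ∉ T.1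
  · exact koszulD_koszulHomotopy_of_notMem r j n f T hj
  rw [not_not] at hj
  obtain ⟨m, rfl⟩ : ∃ m, n = m + 1 :=
    Nat.exists_eq_succ_of_ne_zero (T.2 ▸ Finset.card_ne_zero_of_mem hj)
  -- The cycle equation at `U = T \ {j}` isolates `r_j f(T)`; its other terms agree up to a common
  -- sign with those of the boundary at `T`.
  obtain ⟨U, hU, hT⟩ : ∃ U : Finset ι, j ∉ U ∧ T.1 = insert j U :=
    ⟨T.1.erase j, Finset.notMem_erase _ _, (Finset.insert_erase hj).symm⟩
  have hUc : U.card = m := by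
    have := T.2
    rw [hT, Finset.card_insert_of_notMem hU] at this
    omega
  -- Extending `f` to all finite sets removes the cardinality proofs from its arguments.
  obtain ⟨F, hF⟩ : ∃ F : Finset ι → R, ∀ (S : Finset ι) (h : S.card = m + 1), f ⟨S, h⟩ = F S :=
    ⟨fun S => if h : S.card = m + 1 then f ⟨S, h⟩ else 0, fun S h => by simp only [dif_pos h]⟩
  have hcyc := congrFun (hf m rfl) ⟨U, hUc⟩
  change (∑ k : {k : ι // k ∉ U}, (-1) ^ (U.filter (fun i => i < k.1)).card * r k.1 *
      f ⟨insert k.1 U, _⟩) = 0 at hcyc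
  simp only [hF] at hcyc
  rw [← Finset.sum_subtype Uᶜ (fun _ => Finset.mem_compl)
    (fun k => (-1) ^ (U.filter (fun i => i < k)).card * r k * F (insert k U)),
    show Uᶜ = insert j (insert j U)ᶜ from ?_, Finset.sum_insert (by simp)] at hcyc
  swap
  · ext k
    by_cases hk : k = j <;> simp [hk, hU]
  have hhom : ∀ k : {k : ι // k ∉ T.1}, ∀ h, koszulHomotopy j (m + 1) f ⟨insert k.1 T.1, h⟩ =
      (-1) ^ ((insert k.1 U).filter (fun i => i < j)).card * F (insert k.1 U) := by
    rintro ⟨k, hk⟩ h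
    have hkj : k ∉ insert j U := hT ▸ hk
    rw [Finset.mem_insert, not_or] at hkj
    have hers : (insert k T.1).erase j = insert k U := by
      rw [hT, Finset.insert_comm, Finset.erase_insert]
      rw [Finset.mem_insert, not_or]
      exact ⟨Ne.symm hkj.1, hU⟩
    rw [koszulHomotopy, dif_pos (Finset.mem_insert_of_mem hj), hF]
    simp only [hers]
  have hsum : koszulD r (m + 1) (koszulHomotopy j (m + 1) f) T =
      ∑ k : {k : ι // k ∉ T.1}, (-1) ^ (T.1.filter (fun i => i < k.1)).card * r k.1 *
        ((-1) ^ ((insert k.1 U).filter (fun i => i < j)).card * F (insert k.1 U)) :=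
    Finset.sum_congr rfl fun k _ => by rw [hhom]
  rw [hsum, ← Finset.sum_subtype (insert j U)ᶜ (fun _ => by rw [hT, Finset.mem_compl])
    (fun k => (-1) ^ (T.1.filter (fun i => i < k)).card * r k *
      ((-1) ^ ((insert k U).filter (fun i => i < j)).card * F (insert k U)))]
  have hterm : ∀ k ∈ (insert j U)ᶜ, (-1) ^ (T.1.filter (fun i => i < k)).card * r k *
      ((-1) ^ ((insert k U).filter (fun i => i < j)).card * F (insert k U)) =
      -(-1) ^ (U.filter (fun i => i < j)).card *
        ((-1) ^ (U.filter (fun i => i < k)).card * r k * F (insert k U)) := by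
    intro k hk
    rw [Finset.mem_compl, Finset.mem_insert, not_or] at hk
    rw [hT, Finset.filter_insert, Finset.filter_insert]
    -- Exactly one of the two sign exponents grows by one, whichever of `j`, `k` is smaller.
    rcases lt_or_gt_of_ne hk.1 with h | h
    · rw [if_neg h.not_gt, if_pos h,
        Finset.card_insert_of_notMem fun h' => hk.2 (Finset.mem_filter.1 h').1]
      ring
    · rw [if_pos h, if_neg h.not_gt,
        Finset.card_insert_of_notMem fun h' => hU (Finset.mem_filter.1 h').1]
      ring
  have hfT : f T = F (insert j U) := by
    rw [← hT, ← hF T.1 T.2]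
  have hsq : ((-1 : R)) ^ (U.filter (fun i => i < j)).card *
      (-1) ^ (U.filter (fun i => i < j)).card = 1 := by
    rw [← mul_pow]
    simp
  rw [Finset.sum_congr rfl hterm, ← Finset.mul_sum, Pi.smul_apply, smul_eq_mul, hfT]
  linear_combination -(-1) ^ (U.filter (fun i => i < j)).card * hcyc +
    r j * F (insert j U) * hsq

theorem koszulComplex_d (r : ι → R) (n : ℕ) :
    ((koszulComplex r).d (n + 1) n).hom = koszulD r n := by
  have h : (koszulComplex r).d (n + 1) n = ModuleCat.ofHom (koszulD r n) :=
    ChainComplex.of_d (fun n => ModuleCat.of R (KoszulChain R ι n))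
      (fun n => ModuleCat.ofHom (koszulD r n)) n
  rw [h]
  rfl

/-- The ideal generated by a family annihilates the homology of its Koszul complex. -/
theorem smul_koszulHomology_eq_zero (r : ι → R) (n : ℕ) {a : R}
    (ha : a ∈ Ideal.span (Set.range r)) (m : (koszulComplex r).homology n) : a • m = 0 := by
  have hle : Ideal.span (Set.range r) ≤ Module.annihilator R ((koszulComplex r).homology n) := by
    rw [Ideal.span_le]
    rintro _ ⟨j, rfl⟩
    refine Module.mem_annihilator.2 (smul_homology_eq_zero _ n (r j) fun z hz => ?_)
    rw [koszulComplex_d]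
    refine ⟨koszulHomotopy j n z, koszulD_koszulHomotopy r j n z ?_⟩
    rintro k rfl
    have := hz k
    rw [koszulComplex_d] at this
    exact this
  exact Module.mem_annihilator.1 (hle ha) m

/-- The boundaries of degree zero in a Koszul complex are the elements of the ideal generated by
the family. -/
theorem mem_range_koszulD_zero (r : ι → R) (z : KoszulChain R ι 0)
    (hz : z ∈ LinearMap.range (koszulD r 0)) (T : {S : Finset ι // S.card = 0}) :
    z T ∈ Ideal.span (Set.range r) := by
  obtain ⟨y, rfl⟩ := hz
  refine Ideal.sum_mem _ fun j _ => Ideal.mul_mem_right _ _ (Ideal.mul_mem_left _ _ ?_)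
  exact Ideal.subset_span ⟨j.1, rfl⟩

theorem smul_koszulHomology_zero_iff (r : ι → R) (a : R) :
    (∀ m : (koszulComplex r).homology 0, a • m = 0) ↔ a ∈ Ideal.span (Set.range r) := by
  refine ⟨fun h => ?_, fun h => smul_koszulHomology_eq_zero r 0 h⟩
  rw [smul_homology_zero_iff, koszulComplex_d] at h
  -- Tested on the generator of the chains of degree 0, which form a free module of rank 1.
  have := mem_range_koszulD_zero r _ (h fun _ => 1) ⟨∅, rfl⟩
  change a * 1 ∈ _ at this
  rwa [mul_one] at this

end Koszul

/-! ### Extension of scalars -/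

open CategoryTheory TensorProduct in
/-- The annihilator of the zeroth homology of a Koszul complex after extension of scalars. -/
theorem smul_extendScalars_koszulHomology_zero_iff {R S : Type v} [CommRing R] [CommRing S]
    (φ : R →+* S) {ι : Type u} [Fintype ι] [LinearOrder ι] (r : ι → R) (a : S) :
    (∀ m : (((ModuleCat.extendScalars.{v, v, max u v} φ).mapHomologicalComplex _).obj
      (koszulComplex r)).homology 0, a • m = 0) ↔ a ∈ (Ideal.span (Set.range r)).map φ := by
  rw [smul_homology_zero_iff]
  let := φ.toAlgebra
  set K := koszulComplex r with hK
  have hd : ∀ (s : S) (y : KoszulChain R ι 1),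
      (((ModuleCat.extendScalars.{v, v, max u v} φ).mapHomologicalComplex _).obj K).d 1 0
        (s ⊗ₜ[R] y : S ⊗[R] KoszulChain R ι 1) =
      (s ⊗ₜ[R] koszulD r 0 y : S ⊗[R] KoszulChain R ι 0) := by
    intro s y
    rw [← koszulComplex_d]
    rfl
  constructor
  · intro h
    -- Evaluation at `∅` identifies the chains of degree 0 with `S`.
    let ev : S ⊗[R] KoszulChain R ι 0 →ₗ[R] S :=
      TensorProduct.lift ((LinearMap.mul R S).compl₂
        ((Algebra.linearMap R S).comp (LinearMap.proj ⟨∅, rfl⟩)))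
    have hev : ∀ (s : S) (f : KoszulChain R ι 0), ev (s ⊗ₜ f) = s * φ (f ⟨∅, rfl⟩) :=
      fun s f => rfl
    obtain ⟨y, hy⟩ := h ((1 : S) ⊗ₜ[R] (fun _ => 1 : KoszulChain R ι 0) :)
    have hmem : ∀ y : S ⊗[R] KoszulChain R ι 1,
        ev ((((ModuleCat.extendScalars.{v, v, max u v} φ).mapHomologicalComplex _).obj K).d 1 0 y)
          ∈ (Ideal.span (Set.range r)).map φ := by
      intro y
      induction y using TensorProduct.induction_on with
      | zero =>
        erw [map_zero]
        exact Ideal.zero_mem _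
      | tmul s y => 
        erw [hd, hev]
        exact Ideal.mul_mem_left _ _ (Ideal.mem_map_of_mem _
          (mem_range_koszulD_zero r _ ⟨y, rfl⟩ _))
      | add y z hy hz =>
        erw [map_add, map_add]
        exact Ideal.add_mem _ hy hz
    have h1 := hmem y
    erw [hy] at h1
    have h2 : a • ((1 : S) ⊗ₜ[R] (fun _ => 1 : KoszulChain R ι 0)) =
        a ⊗ₜ[R] (fun _ => 1 : KoszulChain R ι 0) := by
      rw [TensorProduct.smul_tmul', smul_eq_mul, mul_one]
    have h3 : ev (a • ((1 : S) ⊗ₜ[R] (fun _ => 1 : KoszulChain R ι 0))) = a := by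
      rw [h2, hev, map_one, mul_one]
    rw [← h3]
    exact h1
  · intro h z
    set N := LinearMap.range ((((ModuleCat.extendScalars.{v, v, max u v} φ).mapHomologicalComplex
      _).obj K).d 1 0).hom
    refine Submodule.span_induction (p := fun a _ => a • z ∈ N) ?_ ?_ ?_ ?_ h
    · rintro _ ⟨b, hb, rfl⟩
      -- On pure tensors `b • f` is already a boundary over `R`, and tensoring with `s` keeps it
      -- one.
      have key : ∀ z : S ⊗[R] KoszulChain R ι 0, ∃ y : S ⊗[R] KoszulChain R ι 1,
          (((ModuleCat.extendScalars.{v, v, max u v} φ).mapHomologicalComplex _).obj K).d 1 0 y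
            = φ b • z := by
        intro z
        induction z using TensorProduct.induction_on with
        | zero => exact ⟨0, by rw [smul_zero]; exact map_zero _⟩
        | tmul s f =>
          have hf := (smul_homology_zero_iff K b).1 ((smul_koszulHomology_zero_iff r b).2 hb) f
          rw [koszulComplex_d] at hf
          obtain ⟨y, hy⟩ := hf
          have hs : s ⊗ₜ[R] (b • f) = φ b • (s ⊗ₜ[R] f) := by
            rw [TensorProduct.tmul_smul, ← algebraMap_smul S b]
            rfl
          exact ⟨s ⊗ₜ y, (hd s y).trans ((congrArg (fun g : KoszulChain R ι 0 => s ⊗ₜ[R] g) hy).trans hs)⟩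
        | add z w hz hw =>
          obtain ⟨y, hy⟩ := hz
          obtain ⟨y', hy'⟩ := hw
          refine ⟨y + y', ?_⟩
          rw [smul_add, ← hy, ← hy']
          exact map_add _ _ _
      exact key z
    · rw [zero_smul]
      exact N.zero_mem
    · intro a b _ _ ha hb
      rw [add_smul]
      exact N.add_mem ha hb
    · intro c a _ ha
      rw [smul_eq_mul, mul_smul]
      exact N.smul_mem c ha

/-! ### Quotients of `k[x]` -/

theorem edgeInclusion_X (k : Type w) [CommRing k] {E : Type v} (x : E) :
    edgeInclusion k x Polynomial.X = MvPolynomial.X x :=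
  Polynomial.aeval_X _

/-- The dimension of a quotient depends only on the zero locus, here that of `(X)`, and `k[X]/(X) ≅
k`. -/
theorem ringKrullDim_quotient_of_X_pow_mem {k : Type w} [CommRing k] {J : Ideal (Polynomial k)}
    {n : ℕ} (hn : Polynomial.X ^ n ∈ J) (hJ : J ≤ Ideal.span {Polynomial.X}) :
    ringKrullDim (Polynomial k ⧸ J) = ringKrullDim k := by
  have hz : PrimeSpectrum.zeroLocus (J : Set (Polynomial k)) =
      PrimeSpectrum.zeroLocus (Ideal.span {Polynomial.X} : Ideal (Polynomial k)) := by
    refine le_antisymm (fun p hp => ?_) (PrimeSpectrum.zeroLocus_anti_mono hJ)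
    rw [PrimeSpectrum.zeroLocus_span]
    exact Set.singleton_subset_iff.2 (p.2.mem_of_pow_mem n (hp hn))
  have e := Polynomial.quotientSpanXSubCAlgEquiv (0 : k)
  rw [Polynomial.C_0, sub_zero] at e
  rw [ringKrullDim_quotient, hz, ← ringKrullDim_quotient]
  exact ringKrullDim_eq_of_ringEquiv e.toRingEquiv

theorem finite_int_quotient_of_X_pow_mem {J : Ideal (Polynomial ℤ)} {n : ℕ}
    (hn : Polynomial.X ^ n ∈ J) : Module.Finite ℤ (Polynomial ℤ ⧸ J) := by
  have hfin : Module.Finite ℤ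
      (Polynomial ℤ ⧸ Ideal.span {(Polynomial.X ^ n : Polynomial ℤ)}) :=
    (Polynomial.monic_X_pow n).finite_adjoinRoot
  have hle : Ideal.span {(Polynomial.X ^ n : Polynomial ℤ)} ≤ J :=
    (Ideal.span_singleton_le_iff_mem _).2 hn
  exact Module.Finite.of_surjective (Ideal.Quotient.factor hle).toIntAlgHom.toLinearMap
    (Ideal.Quotient.factor_surjective hle)

theorem not_finite_int_quotient_bot :
    ¬ Module.Finite ℤ (Polynomial ℤ ⧸ (⊥ : Ideal (Polynomial ℤ))) := by
  intro h
  exact Polynomial.not_finite (R := ℤ) (Module.Finite.of_surjective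
    (RingEquiv.quotientBot (Polynomial ℤ)).toRingHom.toIntAlgHom.toLinearMap
    (RingEquiv.quotientBot (Polynomial ℤ)).surjective)

/-! ### Intersection of the incidence ideal with `k[x]` -/

namespace DirectedGraph

variable {V : Type u} {E : Type v} [DecidableEq V] [Fintype E] (G : DirectedGraph V E) (x : E)

section
variable [Fintype V] [LinearOrder G.RelationIndex]

theorem annOver_KRHomology_zero :
    annOver (edgeInclusion ℤ x) (G.KRHomology 0) =
      G.incidenceIdeal.comap (edgeInclusion ℤ x) :=
  Ideal.ext fun a => smul_koszulHomology_zero_iff G.relations (edgeInclusion ℤ x a)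

/-- The summand in degree 0 gives one inclusion; the ideal killing every summand gives the other. -/
theorem annOver_totalKRHomology :
    annOver (edgeInclusion ℤ x) G.TotalKRHomology =
      G.incidenceIdeal.comap (edgeInclusion ℤ x) := by
  refine le_antisymm (fun a ha => ?_) fun a ha m => ?_
  · rw [← annOver_KRHomology_zero]
    intro m
    have h := ha (DirectSum.lof (MvPolynomial E ℤ) ℕ (fun n => G.KRHomology n) 0 m)
    rw [← map_smul] at h
    exact (DirectSum.of_injective (β := fun n => G.KRHomology n) 0) (h.trans (map_zero _).symm)
  · refine DFinsupp.ext fun n => ?_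
    exact smul_koszulHomology_eq_zero G.relations n ha (m n)

theorem annOver_KRHomologyRatZero :
    annOver (edgeInclusion ℚ x) G.KRHomologyRatZero =
      (G.incidenceIdeal.map (MvPolynomial.map (Int.castRingHom ℚ))).comap (edgeInclusion ℚ x) :=
  Ideal.ext fun a => smul_extendScalars_koszulHomology_zero_iff _ G.relations
    (edgeInclusion ℚ x a)

end

/-- The extension to `k` of the incidence ideal meets `k[x]` in multiples of `x`. -/
theorem comap_map_incidenceIdeal_le_span_X (k : Type w) [CommRing k] :
    (G.incidenceIdeal.map (MvPolynomial.map (Int.castRingHom k))).comap (edgeInclusion k x) ≤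
      Ideal.span {Polynomial.X} := by
  -- Sending all edges to zero satisfies the relations and reads off the constant coefficient on
  -- `k[x]`.
  let ψ : MvPolynomial E k →ₐ[k] k := MvPolynomial.aeval fun _ => 0
  have hψ : G.incidenceIdeal.map (MvPolynomial.map (Int.castRingHom k)) ≤
      RingHom.ker ψ.toRingHom := by
    rw [Ideal.map_le_iff_le_comap, RingHom.comap_ker, incidenceIdeal_le_ker_iff]
    intro v l
    have h0 : ∀ e, (ψ.toRingHom.comp (MvPolynomial.map (Int.castRingHom k)))
        (MvPolynomial.X e) = 0 := fun e => by simp [ψ]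
    simp only [h0, Multiset.map_const']
    rw [← add_zero (Multiset.replicate _ _), Multiset.esymm_replicate_zero_add,
      ← add_zero (Multiset.replicate _ _), Multiset.esymm_replicate_zero_add]
  intro a ha
  rw [Ideal.mem_span_singleton, Polynomial.X_dvd_iff, Polynomial.coeff_zero_eq_aeval_zero]
  have h : ψ (edgeInclusion k x a) = 0 := hψ ha
  have hid : ψ.comp (Polynomial.aeval (MvPolynomial.X x)) = Polynomial.aeval 0 :=
    Polynomial.algHom_ext (by simp [ψ])
  exact (DFunLike.congr_fun hid a).symm.trans h

/-- If `x` lies on a directed cycle, then the incidence ideal does not meet `k[x]`. -/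
theorem comap_map_incidenceIdeal_eq_bot (k : Type w) [CommRing k] {x : E}
    (hx : G.HasCycleThrough x) :
    (G.incidenceIdeal.map (MvPolynomial.map (Int.castRingHom k))).comap (edgeInclusion k x) =
      ⊥ := by
  classical
  obtain ⟨C, i, rfl⟩ := hx
  let ψ : MvPolynomial E k →ₐ[k] Polynomial k :=
    MvPolynomial.aeval fun e => if e ∈ Set.range C.edge then Polynomial.X else 0
  have hψ : G.incidenceIdeal.map (MvPolynomial.map (Int.castRingHom k)) ≤
      RingHom.ker ψ.toRingHom := by
    rw [Ideal.map_le_iff_le_comap, RingHom.comap_ker]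
    exact C.incidenceIdeal_le_ker Polynomial.X _ fun e => by simp [ψ]
  refine le_antisymm (fun a ha => ?_) bot_le
  have h : ψ (edgeInclusion k (C.edge i) a) = 0 := hψ ha
  -- On `k[x]` the specialization is the identity, so nothing nonzero there is killed.
  have hid : ψ.comp (Polynomial.aeval (MvPolynomial.X (C.edge i))) = AlgHom.id k _ :=
    Polynomial.algHom_ext (by simp [ψ])
  exact (DFunLike.congr_fun hid a).symm.trans h

end DirectedGraph

/-! ### The equivalences -/

theorem ringKrullDim_int : ringKrullDim ℤ = 1 :=
  IsPrincipalIdealRing.ringKrullDim_eq_one ℤ Int.not_isField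

theorem mainTheorem7 {V : Type u} {E : Type v} [Fintype V] [DecidableEq V] [Fintype E]
    (G : DirectedGraph V E) [LinearOrder G.RelationIndex] (x : E) :
    List.TFAE [
      ¬ G.HasCycleThrough x,
      Module.Finite ℤ (Polynomial ℤ ⧸ annOver (edgeInclusion ℤ x) (G.KRHomology 0)),
      Module.Finite ℤ (Polynomial ℤ ⧸ annOver (edgeInclusion ℤ x) G.TotalKRHomology),
      ∃ n : ℕ, 1 ≤ n ∧ (MvPolynomial.X x : MvPolynomial E ℤ) ^ n ∈ G.incidenceIdeal,
      KdimOver (edgeInclusion ℤ x) (G.KRHomology 0) = 1,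
      KdimOver (edgeInclusion ℚ x) G.KRHomologyRatZero = 0] ∧
    (G.HasCycleThrough x ↔
      KdimOver (edgeInclusion ℤ x) (G.KRHomology 0) =
        KdimOver (edgeInclusion ℚ x) G.KRHomologyRatZero + 1 ∧
      KdimOver (edgeInclusion ℚ x) G.KRHomologyRatZero = 1) := by
  -- Lets the lemmas on the extended ideal apply with `k = ℤ`.
  have hmap : G.incidenceIdeal =
      G.incidenceIdeal.map (MvPolynomial.map (Int.castRingHom ℤ)) := by
    rw [show MvPolynomial.map (Int.castRingHom ℤ) = RingHom.id (MvPolynomial E ℤ) from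
      RingHom.ext MvPolynomial.map_id, Ideal.map_id]
  rw [KdimOver, KdimOver, G.annOver_totalKRHomology, G.annOver_KRHomology_zero,
    G.annOver_KRHomologyRatZero]
  by_cases hx : G.HasCycleThrough x
  · have hbot := G.comap_map_incidenceIdeal_eq_bot ℤ hx
    rw [← hmap] at hbot
    have h4 : ¬ ∃ n : ℕ, 1 ≤ n ∧
        (MvPolynomial.X x : MvPolynomial E ℤ) ^ n ∈ G.incidenceIdeal := by
      rintro ⟨n, -, hn⟩
      have hn' : Polynomial.X ^ n ∈ G.incidenceIdeal.comap (edgeInclusion ℤ x) := by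
        rwa [Ideal.mem_comap, map_pow, edgeInclusion_X]
      rw [hbot, Ideal.mem_bot] at hn'
      exact pow_ne_zero _ Polynomial.X_ne_zero hn'
    have hZ : ringKrullDim (Polynomial ℤ ⧸ (⊥ : Ideal (Polynomial ℤ))) = 1 + 1 := by
      rw [ringKrullDim_eq_of_ringEquiv (RingEquiv.quotientBot _),
        Polynomial.ringKrullDim_of_isNoetherianRing, ringKrullDim_int]
    have hQ : ringKrullDim (Polynomial ℚ ⧸ (⊥ : Ideal (Polynomial ℚ))) = 1 := by
      rw [ringKrullDim_eq_of_ringEquiv (RingEquiv.quotientBot _),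
        Polynomial.ringKrullDim_of_isNoetherianRing, ringKrullDim_eq_zero_of_field, zero_add]
    rw [hbot, G.comap_map_incidenceIdeal_eq_bot ℚ hx, hZ, hQ]
    have h12 : ((1 : WithBot ℕ∞) + 1 = 1) ↔ False := by
      rw [iff_false]; decide
    -- With a cycle all six statements are false.
    simp only [hx, h4, not_finite_int_quotient_bot, h12, one_ne_zero, not_true]
    exact ⟨by tfae_finish, by simp⟩
  · obtain ⟨n, h1n, hn⟩ := G.exists_pow_mem_incidenceIdeal hx
    have hnZ : Polynomial.X ^ n ∈ G.incidenceIdeal.comap (edgeInclusion ℤ x) := by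
      rwa [Ideal.mem_comap, map_pow, edgeInclusion_X]
    have hnQ : Polynomial.X ^ n ∈ (G.incidenceIdeal.map
        (MvPolynomial.map (Int.castRingHom ℚ))).comap (edgeInclusion ℚ x) := by
      rw [Ideal.mem_comap, map_pow, edgeInclusion_X]
      simpa using Ideal.mem_map_of_mem (MvPolynomial.map (Int.castRingHom ℚ)) hn
    have hle := G.comap_map_incidenceIdeal_le_span_X x ℤ
    rw [← hmap] at hle
    rw [ringKrullDim_quotient_of_X_pow_mem hnZ hle, ringKrullDim_int,
      ringKrullDim_quotient_of_X_pow_mem hnQ (G.comap_map_incidenceIdeal_le_span_X x ℚ),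
      ringKrullDim_eq_zero_of_field]
    have h4 : ∃ n : ℕ, 1 ≤ n ∧
        (MvPolynomial.X x : MvPolynomial E ℤ) ^ n ∈ G.incidenceIdeal := ⟨n, h1n, hn⟩
    -- Without a cycle all six hold, and the rational dimension 0 refutes the final clause.
    simp only [hx, h4, finite_int_quotient_of_X_pow_mem hnZ]
    simp only [zero_add, zero_ne_one, not_false_eq_true, and_false, and_true]
    tfae_finish
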